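/- All graphs are finite and simple. Let $H$ and $G$ be graphs with $V(H)\subseteq V(G)$. An \emph{$H$-scheme} in $G$ is a family of paths $\{P_{uv} : uv\in E(H)\}$ such that (1) each $P_{uv}$ is a $u,v$-path in $G$ with $V(P_{uv})\cap V(H)=\{u,v\}$; and (2) whenever $e_1,\dots,e_k\in E(H)$ ($k\ge 1$) satisfy $V(P_{e_1})\cap\dots\cap V(P_{e_k})\ne\emptyset$, there is a vertex $u\in V(H)$ incident with each of $e_1,\dots,e_k$. We say that $G$ has a \emph{rooted $H$-minor} if there are pairwise vertex-disjoint connected subgraphs $C_v$ of $G$ $(v\in V(H))$ such that $v\in V(C_v)$ for every $v\in V(H)$ and, for every edge $uv\in E(H)$, there is an edge of $G$ between $C_u$ and $C_v$. A graph $H$ is \emph{rooted-contractible} (or just \emph{contractible}) if every graph $G$ with $V(H)\subseteq V(G)$ that contains an $H$-scheme has a rooted $H$-minor. \textbf{Theorem.} Every rooted-contractible graph is 6-colorable; equivalently, no graph of chromatic number at least $7$ is rooted-contractible. -/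

import Mathlib

universe u

/-- A scheme of `H` in `G`. The inclusion `V(H) ⊆ V(G)` is the embedding `r`; `P e` is the scheme-path
of the edge `e`, a subgraph of `G`. -/
structure IsScheme {V W : Type u} (H : SimpleGraph V) (G : SimpleGraph W) (r : V ↪ W)
    (P : H.edgeSet → G.Subgraph) : Prop where
  /-- `P uv` is a `u,v`-path in `G`. -/
  isPath : ∀ (a b : V) (h : H.Adj a b),
    ∃ p : G.Walk (r a) (r b), p.IsPath ∧ P ⟨s(a, b), h⟩ = p.toSubgraph
  /-- `V(P uv) ∩ V(H) = {u, v}`. -/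
  verts_inter : ∀ (a b : V) (h : H.Adj a b),
    (P ⟨s(a, b), h⟩).verts ∩ Set.range r = {r a, r b}
  /-- Edges of `H` whose paths all share a vertex of `G` have a common endpoint in `H`. -/
  common_endpoint : ∀ S : Set H.edgeSet, S.Nonempty →
    (⋂ e ∈ S, (P e).verts).Nonempty → ∃ a : V, ∀ e ∈ S, a ∈ (e : Sym2 V)

/-- `G` contains `H` as a rooted minor, with roots given by `r`: there are pairwise vertex-disjoint
connected (hence nonempty) subgraphs `C v` of `G` with `v ∈ C v`, and an edge of `G` between `C a`
and `C b` for every edge `ab` of `H`. -/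
def HasRootedMinor {V W : Type u} (H : SimpleGraph V) (G : SimpleGraph W) (r : V ↪ W) : Prop :=
  ∃ C : V → G.Subgraph,
    (∀ v, (C v).Connected) ∧
    (∀ a b, a ≠ b → Disjoint (C a).verts (C b).verts) ∧
    (∀ v, r v ∈ (C v).verts) ∧
    (∀ a b, H.Adj a b → ∃ x ∈ (C a).verts, ∃ y ∈ (C b).verts, G.Adj x y)

/-- A finite graph `H` is (rooted-)contractible if every finite graph `G` with `V(H) ⊆ V(G)` that
contains a scheme of `H` contains `H` as a rooted minor. -/
def IsRootedContractible {V : Type u} [Finite V] (H : SimpleGraph V) : Prop :=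
  ∀ (W : Type u) [Finite W] (G : SimpleGraph W) (r : V ↪ W),
    (∃ P : H.edgeSet → G.Subgraph, IsScheme H G r P) → HasRootedMinor H G r

/-!
A rooted-contractible graph `H` contains no theta graph (two vertices joined by three internally
disjoint paths) whose paths have lengths odd, odd and even and whose cycles have length at least
five; and a graph without such a theta graph is 6-colourable.

**Theta graphs.** Let `K` be such a theta graph in `H`. Take a primed vertex `i'` for each vertex `i`
of `K`, replace each edge `ij` of `K` by the path `i, j', i', j`, and keep the other edges of `H`
(`schemeGraph`). These paths form a scheme, since all paths through `i'` belong to edges at `i`.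
Suppose that there is a rooted minor, and let `S` be the set of vertices of `K` whose branch set has
no primed vertex. It is independent. The branch set of a neighbour `b` of `a ∈ S` must contain a
primed neighbour of the root `a`; as `K` has no triangle, that is not the primed neighbour through
which the branch set leaves its root `b`, so it contains two primed vertices. Counting primed
vertices, the neighbourhood of `S` is at most as large as `S`. But nonempty independent sets of `K`
expand strictly: an odd cycle and a matching span `K`, and equality would propagate along them until
`S` contains two adjacent vertices (`card_lt_card_neighbors`). So `S` is empty and each branch set
has exactly one primed vertex `(π i)'`. As `K` has no cycle of length three or four, each edge of `K`
has the form `{i, π i}`, but `K` has more edges than vertices (`no_assignment`).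

**Colouring.** In a normal spanning forest of `H` each edge joins a vertex to an ancestor. The parity
of the depth colours properly all edges but those between vertices of the same parity, and it
suffices to colour the graph of these edges with three colours (`exists_three_coloring`). A deepest
vertex `v` with two such neighbours or fewer can be removed. If it has three or more, then, as there
is no theta graph, these are its ancestors at distances `2`, `j` and `j + 2` for some `j ≥ 4`.
Further theta graphs show that the grandparent `g` of `v` has only one neighbour among its own
ancestors, and that all its neighbours below have the same three neighbours as `v`. Therefore `g` and
these vertices can be removed together.
-/

open SimpleGraph

/-! ### Theta graphs -/

/-- A theta graph (two branch vertices joined by three internally disjoint paths), presented by a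
Hamiltonian path `0, 1, …, n - 1` and the two chords `0 s` and `t (n - 1)`. If `t < s`, the branch
vertices are `s` and `t` and the three paths have lengths `t + 1`, `s - t` and `n - s`. -/
def thetaGraph (n s t : ℕ) : SimpleGraph (Fin n) :=
  SimpleGraph.fromRel fun i j =>
    (i : ℕ) + 1 = j ∨ ((i : ℕ) = 0 ∧ (j : ℕ) = s) ∨ ((i : ℕ) = t ∧ (j : ℕ) + 1 = n)

/-- The parameters for which `thetaGraph n s t` has path lengths odd, even, odd (in the order `t + 1`,
`s - t`, `n - s`) and no cycle of length less than five. The last two fields and `s_ge` say so for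
the cycles of lengths `t + 1 + n - s`, `n - t` and `s + 1`. -/
structure IsThetaParam (n s t : ℕ) : Prop where
  odd_n : n % 2 = 1
  even_s : s % 2 = 0
  even_t : t % 2 = 0
  t_lt : t < s
  s_ge : 4 ≤ s
  s_lt : s < n
  outer : s + 4 ≤ n + t
  right : t + 5 ≤ n

namespace IsThetaParam
variable {n s t : ℕ}

theorem adj_iff (h : IsThetaParam n s t) {i j : Fin n} : (thetaGraph n s t).Adj i j ↔
    ((i : ℕ) + 1 = j ∨ (i : ℕ) = j + 1 ∨ ((i : ℕ) = 0 ∧ (j : ℕ) = s) ∨ ((i : ℕ) = s ∧ (j : ℕ) = 0) ∨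
      ((i : ℕ) = t ∧ (j : ℕ) + 1 = n) ∨ ((i : ℕ) + 1 = n ∧ (j : ℕ) = t)) := by
  obtain ⟨h1, h2, h3, h4, h5, h6, h7, h8⟩ := h
  have := i.2; have := j.2
  simp only [thetaGraph, SimpleGraph.fromRel_adj, ne_eq, Fin.ext_iff]
  omega

theorem not_triangle (h : IsThetaParam n s t) {a b c : Fin n}
    (hab : (thetaGraph n s t).Adj a b) (hbc : (thetaGraph n s t).Adj b c)
    (hca : (thetaGraph n s t).Adj c a) : False := by
  rw [h.adj_iff] at hab hbc hca
  obtain ⟨h1, h2, h3, h4, h5, h6, h7, h8⟩ := h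
  have := a.2; have := b.2; have := c.2
  rcases hab with h | h | h | h | h | h <;> rcases hbc with h' | h' | h' | h' | h' | h' <;> omega

theorem not_square (h : IsThetaParam n s t) {a b c d : Fin n}
    (hab : (thetaGraph n s t).Adj a b) (hbc : (thetaGraph n s t).Adj b c)
    (hcd : (thetaGraph n s t).Adj c d) (hda : (thetaGraph n s t).Adj d a)
    (hac : a ≠ c) (hbd : b ≠ d) : False := by
  rw [h.adj_iff] at hab hbc hcd hda
  obtain ⟨h1, h2, h3, h4, h5, h6, h7, h8⟩ := h
  have := a.2; have := b.2; have := c.2; have := d.2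
  rw [ne_eq, Fin.ext_iff] at hac hbd
  rcases hab with h | h | h | h | h | h <;> rcases hbc with h' | h' | h' | h' | h' | h' <;>
    omega

/-- A permutation of the vertices of a theta graph that sends each vertex to a neighbour: it rotates
the odd cycle `0, 1, …, s` and exchanges the ends of the edges `s + 1, s + 2`, …, `n - 2, n - 1`. -/
def shift (s i : ℕ) : ℕ :=
  if i < s then i + 1 else if i = s then 0 else if i % 2 = 1 then i + 1 else i - 1

/-- Independent sets of a theta graph expand strictly. Since `shift` maps `S` into its
neighbourhood, only equality has to be excluded. -/
theorem card_lt_card_neighbors (h : IsThetaParam n s t) {S : Finset (Fin n)} (hS : S.Nonempty)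
    (hind : ∀ a ∈ S, ∀ b ∈ S, ¬ (thetaGraph n s t).Adj a b) (N : Finset (Fin n))
    (hN : ∀ a ∈ S, ∀ b, (thetaGraph n s t).Adj a b → b ∈ N) : S.card < N.card := by
  by_contra hcon
  push Not at hcon
  have hp := h
  obtain ⟨h1, h2, h3, h4, h5, h6, h7, h8⟩ := hp
  let σ : Fin n → Fin n := fun i => ⟨shift s i, by
    have := i.2
    unfold shift
    split_ifs <;> omega⟩
  have hσ : ∀ i, (σ i : ℕ) = shift s i := fun i => rfl
  have hinj : Function.Injective σ := by
    intro i j hij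
    have h9 : shift s i = shift s j := by rw [← hσ, ← hσ, hij]
    unfold shift at h9
    ext
    split_ifs at h9 <;> omega
  have hadj : ∀ i, (thetaGraph n s t).Adj i (σ i) := by
    intro i
    have := i.2
    rw [h.adj_iff, hσ]
    unfold shift
    split_ifs <;> omega
  have hsub : S.image σ ⊆ N := by
    intro b hb
    obtain ⟨a, ha, rfl⟩ := Finset.mem_image.1 hb
    exact hN a ha _ (hadj a)
  have heq : S.image σ = N :=
    Finset.eq_of_subset_of_card_le hsub (by rwa [Finset.card_image_of_injective _ hinj])
  -- Equality in the count makes `S` closed under a step to a neighbour followed by `σ⁻¹`.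
  have key : ∀ a ∈ S, ∀ b : Fin n, (thetaGraph n s t).Adj a b → ∃ c ∈ S, shift s c = b := by
    intro a ha b hab
    have := hN a ha b hab
    rw [← heq] at this
    obtain ⟨c, hc, rfl⟩ := Finset.mem_image.1 this
    exact ⟨c, hc, rfl⟩
  let P : ℕ → Prop := fun i => ∃ hi : i < n, (⟨i, hi⟩ : Fin n) ∈ S
  have step : ∀ i j k : ℕ, P i → (hj : j < n) →
      (i + 1 = j ∨ i = j + 1 ∨ (i = 0 ∧ j = s) ∨ (i = s ∧ j = 0) ∨
      (i = t ∧ j + 1 = n) ∨ (i + 1 = n ∧ j = t)) →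
      (∀ c, c < n → shift s c = j → c = k) → P k := by
    rintro i j k ⟨hi, hiS⟩ hj hij hk
    obtain ⟨c, hc, hcj⟩ := key _ hiS ⟨j, hj⟩ (h.adj_iff.2 hij)
    have := hk c c.2 hcj
    subst this
    exact ⟨c.2, hc⟩
  have not01 : P 0 → P 1 → False := by
    rintro ⟨h0, h0S⟩ ⟨h1', h1S⟩
    exact hind _ h0S _ h1S (h.adj_iff.2 (Or.inl rfl))
  -- On the odd cycle `0, …, s` the step lowers the index by two, so that it ends at both `0` and `1`.
  have down : ∀ k, ∀ i, i + 2 * k ≤ s → P (i + 2 * k) → P i := by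
    intro k
    induction k with
    | zero => intro i _ hi; simpa using hi
    | succ k ih =>
      intro i his hi
      refine ih i (by omega) (step _ (i + 2 * k + 1) _ hi (by omega) (by omega) ?_)
      intro c hc hcj
      unfold shift at hcj
      split_ifs at hcj <;> omega
  have c2 : P 1 → P s := by
    intro hi
    refine step _ 0 _ hi (by omega) (by omega) ?_
    intro c hc hcj
    unfold shift at hcj
    split_ifs at hcj <;> omega
  have c3 : P 0 → P (s - 1) := by
    intro hi
    refine step _ s _ hi (by omega) (by omega) ?_
    intro c hc hcj
    unfold shift at hcj
    split_ifs at hcj <;> omega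
  have cyc : ∀ i, i ≤ s → ¬ P i := by
    intro i his hi
    rcases Nat.mod_two_eq_zero_or_one i with hm | hm
    · have p0 : P 0 := down (i / 2) 0 (by omega) (by convert hi using 1; omega)
      exact not01 p0 (down ((s - 2) / 2) 1 (by omega) (by convert c3 p0 using 1; omega))
    · have p1 : P 1 := down (i / 2) 1 (by omega) (by convert hi using 1; omega)
      exact not01 (down (s / 2) 0 (by omega) (by convert c2 p1 using 1; omega)) p1
  -- Off the cycle the step moves odd vertices down and even vertices up, until it enters the cycle.
  have odd : ∀ k, s + 1 + 2 * k < n → ¬ P (s + 1 + 2 * k) := by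
    intro k
    induction k with
    | zero =>
      intro _ hi
      refine cyc (s - 1) (by omega) (step _ s _ hi (by omega) (by omega) ?_)
      intro c hc hcj
      unfold shift at hcj
      split_ifs at hcj <;> omega
    | succ k ih =>
      intro _ hi
      refine ih (by omega) (step _ (s + 2 + 2 * k) _ hi (by omega) (by omega) ?_)
      intro c hc hcj
      unfold shift at hcj
      split_ifs at hcj <;> omega
  have even : ∀ k, s + 2 * k < n → ¬ P (n - 1 - 2 * k) := by
    intro k
    induction k with
    | zero =>
      intro _ hi
      rcases Nat.eq_zero_or_pos t with ht | ht
      · refine cyc s (by omega) (step _ t _ hi (by omega) (by omega) ?_)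
        intro c hc hcj
        unfold shift at hcj
        split_ifs at hcj <;> omega
      · refine cyc (t - 1) (by omega) (step _ t _ hi (by omega) (by omega) ?_)
        intro c hc hcj
        unfold shift at hcj
        split_ifs at hcj <;> omega
    | succ k ih =>
      intro _ hi
      refine ih (by omega) (step _ (n - 2 - 2 * k) _ hi (by omega) (by omega) ?_)
      intro c hc hcj
      unfold shift at hcj
      split_ifs at hcj <;> omega
  obtain ⟨i, hi⟩ := hS
  have pi : P i := ⟨i.2, hi⟩
  have hin := i.2
  rcases le_or_gt (i : ℕ) s with his | his
  · exact cyc i his pi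
  · rcases Nat.mod_two_eq_zero_or_one i with hm | hm
    · exact even ((n - 1 - i) / 2) (by omega) (by convert pi using 1; omega)
    · exact odd ((i - s) / 2) (by omega) (by convert pi using 1; omega)

/-- A theta graph has `n + 1` edges, so its edges are not all of the form `{g, π g}`. -/
theorem exists_edge_not_covered (h : IsThetaParam n s t) (π : Fin n → Fin n) :
    ∃ a b, (thetaGraph n s t).Adj a b ∧ π a ≠ b ∧ π b ≠ a := by
  by_contra hcon
  push Not at hcon
  have hp := h
  obtain ⟨h1, h2, h3, h4, h5, h6, h7, h8⟩ := hp
  -- The edges are listed as `k (k + 1)` for `k + 1 < n`, then `0 s` and `t (n - 1)`; the `k`-th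
  -- edge has ends `lo k < hi k`.
  let lo : ℕ → ℕ := fun k => if k + 1 < n then k else if k + 1 = n then 0 else t
  let hi : ℕ → ℕ := fun k => if k + 1 < n then k + 1 else if k + 1 = n then s else n - 1
  have hlo : ∀ k, lo k < n := fun k => by simp only [lo]; split_ifs <;> omega
  have hhi : ∀ k, hi k < n := fun k => by simp only [hi]; split_ifs <;> omega
  have hlt : ∀ k, lo k < hi k := fun k => by simp only [lo, hi]; split_ifs <;> omega
  have hadj : ∀ k, (thetaGraph n s t).Adj ⟨lo k, hlo k⟩ ⟨hi k, hhi k⟩ := fun k => by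
    rw [h.adj_iff]; simp only [lo, hi]; split_ifs <;> omega
  have cov : ∀ k : Fin (n + 1), ∃ g : Fin n, ((g : ℕ) = lo k ∧ (π g : ℕ) = hi k) ∨
      ((g : ℕ) = hi k ∧ (π g : ℕ) = lo k) := by
    intro k
    by_cases hk : π ⟨lo k, hlo k⟩ = ⟨hi k, hhi k⟩
    · exact ⟨_, Or.inl ⟨rfl, congrArg Fin.val hk⟩⟩
    · exact ⟨_, Or.inr ⟨rfl, congrArg Fin.val (hcon _ _ (hadj k) hk)⟩⟩
  choose g hg using cov
  obtain ⟨k, l, hkl, hgkl⟩ := Fintype.exists_ne_map_eq_of_card_lt g (by simp)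
  have hk := hg k
  have hl := hg l
  rw [← hgkl] at hl
  have hk1 := hlt k
  have hl1 := hlt l
  have e1 : lo k = lo l := by omega
  have e2 : hi k = hi l := by omega
  apply hkl
  have := k.2; have := l.2
  ext
  simp only [lo, hi] at e1 e2
  split_ifs at e1 e2 <;> omega

/-- The combinatorial core of the non-existence of a rooted minor. Here `X i` stands for the set of
primed vertices in the branch set of the root `i`: `hclose` says that a branch set with a primed
vertex contains one adjacent to its root, and `hedge` lists the ways in which two branch sets can be
joined. -/
theorem no_assignment (h : IsThetaParam n s t) (X : Fin n → Finset (Fin n))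
    (hdisj : ∀ i j k, k ∈ X i → k ∈ X j → i = j)
    (hclose : ∀ i, (X i).Nonempty → ∃ j ∈ X i, (thetaGraph n s t).Adj i j)
    (hedge : ∀ i k, (thetaGraph n s t).Adj i k →
      (∃ j ∈ X k, (thetaGraph n s t).Adj i j) ∨ (∃ j ∈ X i, (thetaGraph n s t).Adj k j) ∨
      ∃ j ∈ X i, ∃ l ∈ X k, (thetaGraph n s t).Adj j l) : False := by
  classical
  set K := thetaGraph n s t with hK
  let S : Finset (Fin n) := Finset.univ.filter fun i => X i = ∅
  let N : Finset (Fin n) := Finset.univ.filter fun b => ∃ a ∈ S, K.Adj a b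
  have hSm : ∀ i, i ∈ S ↔ X i = ∅ := fun i => by simp [S]
  have hNm : ∀ i, i ∈ N ↔ ∃ a ∈ S, K.Adj a i := fun i => by simp [N]
  have hsum : ∑ i, (X i).card ≤ n := by
    rw [← Finset.card_biUnion]
    · exact (Finset.card_le_univ _).trans (by simp)
    · intro i _ j _ hij
      rw [Function.onFun, Finset.disjoint_left]
      exact fun k hk hk' => hij (hdisj i j k hk hk')
  have hind : ∀ a ∈ S, ∀ b ∈ S, ¬ K.Adj a b := by
    intro a ha b hb hab
    rw [hSm] at ha hb
    simpa [ha, hb] using hedge a b hab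
  have hN2 : ∀ b ∈ N, 2 ≤ (X b).card := by
    intro b hb
    obtain ⟨a, ha, hab⟩ := (hNm b).1 hb
    rw [hSm] at ha
    have := hedge a b hab
    simp only [ha, Finset.notMem_empty, false_and, exists_false, or_false] at this
    obtain ⟨j, hj, haj⟩ := this
    obtain ⟨k, hk, hbk⟩ := hclose b ⟨j, hj⟩
    -- `j` is adjacent to `a`, hence not to `b`, whereas `k` is adjacent to `b`
    refine Finset.one_lt_card.2 ⟨j, hj, k, hk, ?_⟩
    rintro rfl
    exact h.not_triangle hab hbk haj.symm
  -- A branch set outside `S` has a primed vertex, and one in `N` has two; there are `n` in all.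
  have hcount : n + N.card ≤ n + S.card := by
    have h1 : ∀ i, 1 + (if i ∈ N then 1 else 0) ≤ (X i).card + (if i ∈ S then 1 else 0) := by
      intro i
      by_cases hiS : i ∈ S
      · have : i ∉ N := fun hiN => by
          obtain ⟨a, ha, hai⟩ := (hNm i).1 hiN
          exact hind a ha i hiS hai
        simp [hiS, this]
      · have h0 : 0 < (X i).card := Finset.card_pos.2
          (Finset.nonempty_iff_ne_empty.2 fun h0 => hiS ((hSm i).2 h0))
        by_cases hiN : i ∈ N
        · have := hN2 i hiN
          simp only [hiS, hiN, if_true, if_false]; omega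
        · simp only [hiS, hiN, if_false]; omega
    have h2 := Finset.sum_le_sum fun i (_ : i ∈ Finset.univ) => h1 i
    simp only [Finset.sum_add_distrib, Finset.sum_ite_mem, Finset.univ_inter, Finset.sum_const,
      Finset.card_univ, Fintype.card_fin, smul_eq_mul, mul_one] at h2
    omega
  have hSe : S = ∅ := by
    by_contra hne
    have := h.card_lt_card_neighbors (Finset.nonempty_iff_ne_empty.2 hne) hind N
      fun a ha b hab => (hNm b).2 ⟨a, ha, hab⟩
    omega
  have hpos : ∀ i, 1 ≤ (X i).card := fun i => Finset.card_pos.2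
    (Finset.nonempty_iff_ne_empty.2 fun h0 => by simpa [hSe] using (hSm i).2 h0)
  have hone : ∀ i, (X i).card = 1 := by
    have h1 : ∑ _i : Fin n, 1 = ∑ i, (X i).card :=
      le_antisymm (Finset.sum_le_sum fun i _ => hpos i) (by simpa using hsum)
    exact fun i => ((Finset.sum_eq_sum_iff_of_le fun i _ => hpos i).1 h1 i (Finset.mem_univ i)).symm
  -- With exactly one primed vertex `π i` for each `i`, the short cycles that are missing force every
  -- edge `a b` to satisfy `π a = b` or `π b = a`.
  choose π hπ using fun i => Finset.card_eq_one.1 (hone i)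
  have hπadj : ∀ i, K.Adj i (π i) := by
    intro i
    obtain ⟨j, hj, hij⟩ := hclose i ⟨π i, by simp [hπ]⟩
    rw [hπ, Finset.mem_singleton] at hj
    rwa [← hj]
  obtain ⟨a, b, hab, h1, h2⟩ := h.exists_edge_not_covered π
  have := hedge a b hab
  simp only [hπ, Finset.mem_singleton, exists_eq_left] at this
  rcases this with h3 | h3 | h3
  · exact h.not_triangle hab (hπadj b) h3.symm
  · exact h.not_triangle hab h3 (hπadj a).symm
  · exact h.not_square hab (hπadj b) h3.symm (hπadj a).symm h2.symm h1.symm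

end IsThetaParam

/-! ### The graph that carries the scheme -/

/-- The graph that carries a scheme of `H` and tests the subgraph `f(K)` of `H`. Its vertices are the
roots `inl a` and a primed vertex `inr i` for every vertex `i` of `K`. An edge `ij` of `K` gives the
path `f i, j', i', f j`; an edge of `H` outside `f(K)` is kept as an edge between roots. -/
def schemeGraph {V : Type u} {ι : Type} (H : SimpleGraph V) (K : SimpleGraph ι) (f : ι → V) :
    SimpleGraph (V ⊕ ULift.{u} ι) where
  Adj
    | .inl a, .inl b => H.Adj a b ∧ ¬ (K.map f).Adj a b
    | .inl a, .inr j => ∃ i, f i = a ∧ K.Adj i j.down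
    | .inr j, .inl a => ∃ i, f i = a ∧ K.Adj i j.down
    | .inr i, .inr j => K.Adj i.down j.down
  symm := ⟨by
    rintro (a | i) (b | j) h
    · exact ⟨h.1.symm, fun h' => h.2 h'.symm⟩
    · exact h
    · exact h
    · exact SimpleGraph.Adj.symm h⟩
  loopless := ⟨by
    rintro (a | i) h
    · exact h.1.ne rfl
    · exact K.loopless.irrefl _ h⟩

section
variable {V : Type u} {ι : Type} {H : SimpleGraph V} {K : SimpleGraph ι} {f : ι → V}

/-- The scheme path of an edge `ab`. It meets a primed vertex `i'` only if `f i` is an end of the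
edge, so that edges whose paths share `i'` share the end `f i`. -/
theorem exists_path_schemeGraph {a b : V} (hab : H.Adj a b) :
    ∃ p : (schemeGraph H K f).Walk (.inl a) (.inl b), p.IsPath ∧
      (∀ c, Sum.inl c ∈ p.support → c = a ∨ c = b) ∧
      ∀ i, Sum.inr i ∈ p.support → f i.down = a ∨ f i.down = b := by
  by_cases hK : (K.map f).Adj a b
  · obtain ⟨-, i, j, hij, rfl, rfl⟩ := hK
    have h1 : (schemeGraph H K f).Adj (.inl (f i)) (.inr ⟨j⟩) := ⟨i, rfl, hij⟩
    have h2 : (schemeGraph H K f).Adj (.inr ⟨j⟩) (.inr ⟨i⟩) := hij.symm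
    have h3 : (schemeGraph H K f).Adj (.inr ⟨i⟩) (.inl (f j)) := ⟨j, rfl, hij.symm⟩
    refine ⟨.cons h1 (.cons h2 (.cons h3 .nil)), ?_, ?_, ?_⟩
    · simp [Walk.isPath_def, hab.ne, hij.ne']
    · simp
    · rintro ⟨k⟩ hk
      simp at hk
      rcases hk with rfl | rfl <;> simp
  · have h1 : (schemeGraph H K f).Adj (.inl a) (.inl b) := ⟨hab, hK⟩
    exact ⟨.cons h1 .nil, by simp [Walk.isPath_def, hab.ne], by simp, by simp⟩

theorem exists_isScheme_schemeGraph :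
    ∃ P : H.edgeSet → (schemeGraph H K f).Subgraph,
      IsScheme H (schemeGraph H K f) Function.Embedding.inl P := by
  have key : ∀ e : H.edgeSet, ∃ Q : (schemeGraph H K f).Subgraph, ∀ a b, e.1 = s(a, b) →
      ∃ p : (schemeGraph H K f).Walk (.inl a) (.inl b), p.IsPath ∧ Q = p.toSubgraph ∧
      (∀ c, Sum.inl c ∈ p.support → c = a ∨ c = b) ∧
      ∀ i, Sum.inr i ∈ p.support → f i.down = a ∨ f i.down = b := by
    rintro ⟨e, he⟩
    induction e using Sym2.ind with
    | _ a b =>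
      obtain ⟨p, hp, h1, h2⟩ := exists_path_schemeGraph (K := K) (f := f) he
      refine ⟨p.toSubgraph, fun a' b' hab => ?_⟩
      rcases Sym2.eq_iff.1 hab with ⟨rfl, rfl⟩ | ⟨rfl, rfl⟩
      · exact ⟨p, hp, rfl, h1, h2⟩
      · refine ⟨p.reverse, hp.reverse, (Walk.toSubgraph_reverse p).symm, ?_, ?_⟩
        · intro c hc
          rw [Walk.support_reverse, List.mem_reverse] at hc
          exact (h1 c hc).symm
        · intro c hc
          rw [Walk.support_reverse, List.mem_reverse] at hc
          exact (h2 c hc).symm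
  choose P hP using key
  refine ⟨P, ⟨?_, ?_, ?_⟩⟩
  · intro a b h
    obtain ⟨p, hp, hQ, -⟩ := hP ⟨s(a, b), h⟩ a b rfl
    exact ⟨p, hp, hQ⟩
  · intro a b h
    obtain ⟨p, hp, hQ, h1, -⟩ := hP ⟨s(a, b), h⟩ a b rfl
    rw [hQ, Walk.verts_toSubgraph]
    ext x
    constructor
    · rintro ⟨hx, c, rfl⟩
      rcases h1 c hx with rfl | rfl
      · exact Or.inl rfl
      · exact Or.inr rfl
    · rintro (rfl | rfl)
      · exact ⟨p.start_mem_support, _, rfl⟩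
      · exact ⟨p.end_mem_support, _, rfl⟩
  · rintro S - ⟨x, hx⟩
    have hx' : ∀ e ∈ S, x ∈ (P e).verts := fun e he => Set.mem_iInter₂.1 hx e he
    rcases x with c | i
    · refine ⟨c, fun e he => ?_⟩
      obtain ⟨⟨a, b⟩, hab⟩ := Sym2.mk_surjective e.1
      obtain ⟨p, hp, hQ, h1, -⟩ := hP e a b hab.symm
      have := hx' e he
      rw [hQ, Walk.mem_verts_toSubgraph] at this
      rw [← hab]
      exact Sym2.mem_iff.2 (h1 c this)
    · refine ⟨f i.down, fun e he => ?_⟩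
      obtain ⟨⟨a, b⟩, hab⟩ := Sym2.mk_surjective e.1
      obtain ⟨p, hp, hQ, -, h2⟩ := hP e a b hab.symm
      have := hx' e he
      rw [hQ, Walk.mem_verts_toSubgraph] at this
      rw [← hab]
      exact Sym2.mem_iff.2 (h2 i this)

/-- Edges between roots help neither to connect a branch set, which contains one root only, nor to
join the branch sets of two vertices adjacent in the theta graph. Therefore `no_assignment`
applies to the primed vertices. -/
theorem not_isRootedContractible_of_theta [Finite V] {n s t : ℕ} (h : IsThetaParam n s t)
    {f : Fin n → V} (hf : Function.Injective f)
    (hadj : ∀ i j, (thetaGraph n s t).Adj i j → H.Adj (f i) (f j)) :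
    ¬ IsRootedContractible H := by
  classical
  intro hH
  set K := thetaGraph n s t with hK
  obtain ⟨C, hconn, hdisj, hroot, hedge⟩ := hH _ (schemeGraph H K f) _
    exists_isScheme_schemeGraph
  have hinl : ∀ a b, Sum.inl a ∈ (C b).verts → a = b := by
    intro a b hab
    by_contra hne
    exact Set.disjoint_left.1 (hdisj a b hne) (hroot a) hab
  let X : Fin n → Finset (Fin n) := fun i =>
    Finset.univ.filter fun j => Sum.inr ⟨j⟩ ∈ (C (f i)).verts
  have hX : ∀ i j, j ∈ X i ↔ Sum.inr ⟨j⟩ ∈ (C (f i)).verts := fun i j => by simp [X]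
  refine h.no_assignment X ?_ ?_ ?_
  · intro i j k hi hj
    rw [hX] at hi hj
    by_contra hne
    exact Set.disjoint_left.1 (hdisj _ _ fun e => hne (hf e)) hi hj
  · rintro i ⟨k, hk⟩
    rw [hX] at hk
    have : Nontrivial (C (f i)).verts :=
      ⟨⟨⟨_, hroot (f i)⟩, ⟨_, hk⟩, fun e => Sum.inl_ne_inr (congrArg Subtype.val e)⟩⟩
    obtain ⟨x, hx⟩ := (hconn (f i)).preconnected.exists_adj_of_nontrivial ⟨_, hroot (f i)⟩
    have hxm := (C (f i)).edge_vert hx.symm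
    have hxa := hx.adj_sub
    rcases x with c | j
    · rw [hinl c _ hxm] at hxa
      exact absurd rfl hxa.ne
    · obtain ⟨i', hi', hij⟩ := hxa
      rw [hf hi'] at hij
      exact ⟨j.down, (hX i j.down).2 hxm, hij⟩
  · intro i k hik
    obtain ⟨x, hx, y, hy, hxy⟩ := hedge _ _ (hadj i k hik)
    rcases x with a | j <;> rcases y with b | l
    · rw [hinl a _ hx, hinl b _ hy] at hxy
      exact absurd ⟨(hadj i k hik).ne, i, k, hik, rfl, rfl⟩ hxy.2
    · obtain ⟨i', hi', hij⟩ := hxy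
      have := hinl a _ hx
      rw [this] at hi'
      rw [hf hi'] at hij
      exact Or.inl ⟨l.down, (hX k l.down).2 hy, hij⟩
    · obtain ⟨i', hi', hij⟩ := hxy
      have := hinl b _ hy
      rw [this] at hi'
      rw [hf hi'] at hij
      exact Or.inr (Or.inl ⟨j.down, (hX i j.down).2 hx, hij⟩)
    · exact Or.inr (Or.inr ⟨j.down, (hX i j.down).2 hx, l.down, (hX k l.down).2 hy, hxy⟩)

/-- The form in which theta subgraphs are found: a path `u 0, …, u (n - 1)` with two chords. -/
theorem not_isRootedContractible_of_seq [Finite V] {n s t : ℕ} (h : IsThetaParam n s t)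
    (u : ℕ → V) (hinj : ∀ i j, i < j → j < n → u i ≠ u j)
    (hpath : ∀ i, i + 1 < n → H.Adj (u i) (u (i + 1)))
    (hs : H.Adj (u 0) (u s)) (ht : H.Adj (u t) (u (n - 1))) :
    ¬ IsRootedContractible H := by
  refine not_isRootedContractible_of_theta h (f := fun i : Fin n => u i) ?_ ?_
  · intro i j hij
    rcases lt_trichotomy (i : ℕ) j with hlt | heq | hlt
    · exact absurd hij (hinj _ _ hlt j.2)
    · exact Fin.ext heq
    · exact absurd hij.symm (hinj _ _ hlt i.2)
  · intro i j hij
    have hi := i.2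
    have hj := j.2
    rcases h.adj_iff.1 hij with h1 | h1 | ⟨h1, h2⟩ | ⟨h1, h2⟩ | ⟨h1, h2⟩ | ⟨h1, h2⟩
    · rw [← h1]; exact hpath _ (by omega)
    · rw [h1]; exact (hpath _ (by omega)).symm
    · rw [h1, h2]; exact hs
    · rw [h1, h2]; exact hs.symm
    · rw [h1, show (j : ℕ) = n - 1 by omega]; exact ht
    · rw [h2, show (i : ℕ) = n - 1 by omega]; exact ht.symm
end

/-! ### Normal spanning forests -/

/-- A normal (depth-first search) spanning forest of the subgraph of `H` induced by `U`, given by the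
depth `d` (zero at the roots) and the parent map `par`, whose values at the roots carry no meaning:
every edge of `H` inside `U` joins a vertex to one of its ancestors. -/
structure IsNormalForestOn {V : Type u} (H : SimpleGraph V) (U : Finset V) (d : V → ℕ)
    (par : V → V) : Prop where
  par_mem : ∀ v ∈ U, 0 < d v → par v ∈ U
  adj_par : ∀ v ∈ U, 0 < d v → H.Adj v (par v)
  depth_par : ∀ v ∈ U, 0 < d v → d (par v) + 1 = d v
  ancestor : ∀ v ∈ U, ∀ w ∈ U, H.Adj v w → d w ≤ d v → par^[d v - d w] v = w

namespace IsNormalForestOn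
variable {V : Type u} {H : SimpleGraph V} {U : Finset V} {d : V → ℕ} {par : V → V}

theorem iterate_mem_depth (h : IsNormalForestOn H U d par) {v : V} (hv : v ∈ U) :
    ∀ k ≤ d v, par^[k] v ∈ U ∧ d (par^[k] v) + k = d v := by
  intro k
  induction k with
  | zero => intro _; exact ⟨hv, rfl⟩
  | succ k ih =>
    intro hk
    obtain ⟨h1, h2⟩ := ih (by omega)
    rw [Function.iterate_succ_apply']
    have h3 := h.depth_par _ h1 (by omega)
    exact ⟨h.par_mem _ h1 (by omega), by omega⟩

/-- Normal forests exist, and the root of each tree can be required to minimise a given priority `ρ`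
on its tree. The priority makes the induction work: when a vertex `r` is added as a root, each tree
that contains a neighbour of `r` must be rooted at such a neighbour. -/
theorem exists_of_priority (H : SimpleGraph V) (U : Finset V) : ∀ ρ : V → ℕ,
    ∃ d par, IsNormalForestOn H U d par ∧ ∀ v ∈ U, ρ (par^[d v] v) ≤ ρ v := by
  classical
  induction U using Finset.strongInduction with
  | H U ih =>
    intro ρ
    rcases U.eq_empty_or_nonempty with rfl | hU
    · exact ⟨fun _ => 0, id, ⟨by simp, by simp, by simp, by simp⟩, by simp⟩
    obtain ⟨r, hr, hmin⟩ := Finset.exists_min_image U ρ hU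
    obtain ⟨d, par, hF, hρ⟩ := ih (U.erase r) (Finset.erase_ssubset hr)
      (fun v => if H.Adj r v then 0 else ρ v + 1)
    -- The trees whose root is adjacent to `r`, that is those with `A v`, are hung below `r`.
    let A : V → Prop := fun v => H.Adj r (par^[d v] v)
    let d' : V → ℕ := fun v => if v = r then 0 else if A v then d v + 1 else d v
    let par' : V → V := fun v => if d v = 0 then r else par v
    have hmem : ∀ v, v ∈ U.erase r ↔ v ≠ r ∧ v ∈ U := fun v => Finset.mem_erase
    have hApar : ∀ v ∈ U.erase r, 0 < d v → (A (par v) ↔ A v) := by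
      intro v hv h0
      have h1 := hF.depth_par v hv h0
      simp only [A]
      rw [← h1, Function.iterate_succ_apply]
    have hiter : ∀ v, v ∈ U.erase r → ∀ k ≤ d v, par'^[k] v = par^[k] v := by
      intro v hv k
      induction k with
      | zero => intro _; rfl
      | succ k ihk =>
        intro hk
        have h1 := hF.iterate_mem_depth hv k (by omega)
        rw [Function.iterate_succ_apply', Function.iterate_succ_apply', ihk (by omega)]
        simp only [par']
        rw [if_neg (by omega)]
    have hiter' : ∀ v ∈ U.erase r, par'^[d v + 1] v = r := by
      intro v hv
      have h1 := hF.iterate_mem_depth hv (d v) le_rfl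
      rw [Function.iterate_succ_apply', hiter v hv _ le_rfl]
      simp only [par']
      rw [if_pos (by omega)]
    have hnr : ∀ v ∈ U.erase r, d' v = if A v then d v + 1 else d v := by
      intro v hv
      simp only [d']
      rw [if_neg ((hmem v).1 hv).1]
    have hdr : d' r = 0 := by simp [d']
    have hcases : ∀ v ∈ U, v = r ∨ v ∈ U.erase r := by
      intro v hv
      by_cases h : v = r
      · exact Or.inl h
      · exact Or.inr ((hmem v).2 ⟨h, hv⟩)
    have hAr : ∀ v ∈ U.erase r, H.Adj r v → A v := by
      intro v hv hrv
      have := hρ v hv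
      simp only [hrv, if_true] at this
      by_contra hA
      simp only [A] at hA
      rw [if_neg hA] at this
      omega
    have hA0 : ∀ v ∈ U.erase r, d v = 0 → A v → H.Adj v r := by
      intro v hv h0 hA
      simp only [A, h0] at hA
      exact hA.symm
    have hAadj : ∀ v ∈ U.erase r, ∀ w ∈ U.erase r, H.Adj v w → d w ≤ d v → (A v ↔ A w) := by
      intro v hv w hw hvw hle
      have h1 := hF.ancestor v hv w hw hvw hle
      have h2 : par^[d v] v = par^[d w] w := by
        calc par^[d v] v = par^[d w + (d v - d w)] v := by rw [Nat.add_sub_of_le hle]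
          _ = par^[d w] w := by rw [Function.iterate_add_apply, h1]
      simp only [A, h2]
    refine ⟨d', par', ⟨?_, ?_, ?_, ?_⟩, ?_⟩
    · intro v hv h0
      rcases hcases v hv with rfl | hv'
      · omega
      by_cases hd : d v = 0
      · simp only [par', hd, if_true]; exact hr
      · simp only [par', hd, if_false]
        exact ((hmem _).1 (hF.par_mem v hv' (by omega))).2
    · intro v hv h0
      rcases hcases v hv with rfl | hv'
      · omega
      rw [hnr v hv'] at h0
      by_cases hd : d v = 0
      · simp only [par', hd, if_true]
        refine hA0 v hv' hd ?_
        by_contra hA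
        rw [if_neg hA] at h0
        omega
      · simp only [par', hd, if_false]
        exact hF.adj_par v hv' (by omega)
    · intro v hv h0
      rcases hcases v hv with rfl | hv'
      · omega
      rw [hnr v hv'] at h0 ⊢
      by_cases hd : d v = 0
      · have hA : A v := by
          by_contra hA
          rw [if_neg hA] at h0
          omega
        simp only [par', hd, if_true, hdr, if_pos hA]
      · simp only [par', hd, if_false]
        have h1 := hF.depth_par v hv' (by omega)
        rw [hnr _ (hF.par_mem v hv' (by omega))]
        have h2 := hApar v hv' (by omega)
        by_cases hA : A v
        · rw [if_pos hA, if_pos (h2.2 hA)]; omega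
        · rw [if_neg hA, if_neg (fun h => hA (h2.1 h))]; omega
    · intro v hv w hw hvw hle
      rcases hcases v hv with rfl | hv' <;> rcases hcases w hw with rfl | hw'
      · exact absurd rfl hvw.ne
      · rw [hdr, hnr w hw', if_pos (hAr w hw' hvw)] at hle
        omega
      · rw [hdr, hnr v hv', if_pos (hAr v hv' hvw.symm)]
        exact hiter' v hv'
      · have hA : A v ↔ A w := by
          rcases le_total (d w) (d v) with h | h
          · exact hAadj v hv' w hw' hvw h
          · exact (hAadj w hw' v hv' hvw.symm h).symm
        rw [hnr v hv', hnr w hw'] at hle ⊢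
        have hle' : d w ≤ d v := by
          by_cases h : A v
          · rw [if_pos h, if_pos (hA.1 h)] at hle; omega
          · rw [if_neg h, if_neg (fun h' => h (hA.2 h'))] at hle; omega
        have he : (if A v then d v + 1 else d v) - (if A w then d w + 1 else d w) = d v - d w := by
          by_cases h : A v
          · rw [if_pos h, if_pos (hA.1 h)]; omega
          · rw [if_neg h, if_neg (fun h' => h (hA.2 h'))]
        rw [he, hiter v hv' _ (by omega)]
        exact hF.ancestor v hv' w hw' hvw hle'
    · intro v hv
      rcases hcases v hv with rfl | hv'
      · rw [hdr]; exact le_rfl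
      rw [hnr v hv']
      by_cases hA : A v
      · rw [if_pos hA, hiter' v hv']
        exact hmin v hv
      · rw [if_neg hA, hiter v hv' _ le_rfl]
        have := hρ v hv'
        rw [if_neg hA, if_neg (fun h => hA (hAr v hv' h))] at this
        omega

end IsNormalForestOn

/-! ### Theta graphs in a normal spanning forest -/

namespace IsNormalForestOn
variable {V : Type u} [Fintype V] {H : SimpleGraph V} {d : V → ℕ} {par : V → V}

theorem depth_iterate (h : IsNormalForestOn H Finset.univ d par) {v : V} {k : ℕ} (hk : k ≤ d v) :
    d (par^[k] v) + k = d v :=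
  (h.iterate_mem_depth (Finset.mem_univ v) k hk).2

theorem adj_iterate (h : IsNormalForestOn H Finset.univ d par) {v : V} {k : ℕ} (hk : k + 1 ≤ d v) :
    H.Adj (par^[k] v) (par^[k + 1] v) := by
  rw [Function.iterate_succ_apply']
  have := h.depth_iterate (v := v) (k := k) (by omega)
  exact h.adj_par _ (Finset.mem_univ _) (by omega)

theorem iterate_ne (h : IsNormalForestOn H Finset.univ d par) {v w : V} (hvw : d v = d w) {i j : ℕ}
    (hi : i ≤ d v) (hj : j ≤ d v) (hij : i ≠ j) : par^[i] v ≠ par^[j] w := by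
  intro heq
  have h1 := h.depth_iterate hi
  have h2 := h.depth_iterate (v := w) (k := j) (by omega)
  rw [heq] at h1
  omega

/-- The theta graph with path lengths `1`, `i` and `k - i + 1`. -/
theorem not_two_long_chords (h : IsNormalForestOn H Finset.univ d par)
    (hH : IsRootedContractible H) {v : V} {i k : ℕ} (hi : i % 2 = 0) (hk : k % 2 = 0)
    (hi4 : 4 ≤ i) (hik : i + 4 ≤ k) (hkd : k ≤ d v) (hvi : H.Adj v (par^[i] v))
    (hvk : H.Adj v (par^[k] v)) : False :=
  not_isRootedContractible_of_seq (n := k + 1) (s := i) (t := 0)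
    ⟨by omega, by omega, by omega, by omega, by omega, by omega, by omega, by omega⟩
    (fun m => par^[m] v)
    (fun a b hab hb => h.iterate_ne rfl (by omega) (by omega) (by omega))
    (fun a ha => h.adj_iterate (by omega)) hvi hvk hH

/-- The theta graph of two chords from a vertex and its grandparent. Its path lengths are `3`, `a - 2`
and `b - a + 1` if `a < b`, and `1`, `b - 2` and `a - b + 3` if `b < a`. -/
theorem not_crossing_chords (h : IsNormalForestOn H Finset.univ d par)
    (hH : IsRootedContractible H) {v : V} {a b : ℕ} (ha : a % 2 = 0) (hb : b % 2 = 0)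
    (ha4 : 4 ≤ a) (hb6 : 6 ≤ b) (hab : a ≠ b) (had : a ≤ d v) (hbd : b ≤ d v)
    (hva : H.Adj v (par^[a] v)) (hvb : H.Adj (par^[2] v) (par^[b] v)) : False := by
  rcases Nat.lt_or_gt_of_ne hab with hlt | hlt
  · exact not_isRootedContractible_of_seq (n := b + 1) (s := a) (t := 2)
      ⟨by omega, by omega, by omega, by omega, by omega, by omega, by omega, by omega⟩
      (fun m => par^[m] v)
      (fun i j hij hj => h.iterate_ne rfl (by omega) (by omega) (by omega))
      (fun i hi => h.adj_iterate (by omega)) hva hvb hH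
  · -- The path climbs from the grandparent of `v` to its `a`-th ancestor, then goes on to `v` and its
    -- parent.
    refine not_isRootedContractible_of_seq (n := a + 1) (s := b - 2) (t := 0)
      ⟨by omega, by omega, by omega, by omega, by omega, by omega, by omega, by omega⟩
      (fun m => par^[if m + 2 ≤ a then m + 2 else m + 1 - a] v) ?_ ?_ ?_ ?_ hH
    · intro i j hij hj
      apply h.iterate_ne rfl <;> split_ifs <;> omega
    · intro i hi
      rcases lt_trichotomy (i + 2) a with hc | hc | hc
      · rw [if_pos (by omega), if_pos (by omega)]
        exact h.adj_iterate (k := i + 2) (by omega)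
      · rw [if_pos (by omega), if_neg (by omega), hc,
          show a - a = 0 by omega]
        exact hva.symm
      · rw [if_neg (by omega), if_neg (by omega), show i + 1 - a = 0 by omega,
          show i + 1 + 1 - a = 0 + 1 by omega]
        exact h.adj_iterate (by omega)
    · rw [if_pos (by omega), if_pos (by omega), show b - 2 + 2 = b by omega]
      exact hvb
    · rw [if_pos (by omega), if_neg (by omega), show a + 1 - 1 + 1 - a = 1 by omega]
      exact (h.adj_iterate (k := 1) (by omega)).symm

/-- The theta graph with path lengths `3`, `a - 2` and `b - a + 3`, with branch vertices the common
grandparent and the `a`-th ancestor. -/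
theorem not_cousin_chords (h : IsNormalForestOn H Finset.univ d par)
    (hH : IsRootedContractible H) {v w : V} {a b : ℕ} (ha : a % 2 = 0) (hb : b % 2 = 0)
    (ha4 : 4 ≤ a) (hab : a ≤ b) (hbd : b ≤ d v) (hd : d v = d w) (hpar : par v ≠ par w)
    (hgrand : par^[2] v = par^[2] w)
    (hva : H.Adj v (par^[a] v)) (hwb : H.Adj w (par^[b] w)) : False := by
  have hup : ∀ k, par^[k + 2] w = par^[k + 2] v := fun k => by
    rw [Function.iterate_add_apply, ← hgrand, ← Function.iterate_add_apply]
  have hvw : v ≠ w := fun e => hpar (by rw [e])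
  -- The path climbs from `v` to its `b`-th ancestor and returns to `w` and its parent.
  refine not_isRootedContractible_of_seq (n := b + 3) (s := a) (t := 2)
    ⟨by omega, by omega, by omega, by omega, by omega, by omega, by omega, by omega⟩
    (fun m => if m ≤ b then par^[m] v else par^[m - (b + 1)] w) ?_ ?_ ?_ ?_ hH
  · intro i j hij hj
    split_ifs with h1 h2 h2
    · exact h.iterate_ne rfl (by omega) (by omega) (by omega)
    · by_cases hc : i = j - (b + 1)
      · rw [← hc]
        have : i = 0 ∨ i = 1 := by omega
        rcases this with rfl | rfl
        · exact hvw
        · exact hpar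
      · exact h.iterate_ne hd (by omega) (by omega) hc
    · omega
    · exact h.iterate_ne rfl (by omega) (by omega) (by omega)
  · intro i hi
    rcases lt_trichotomy i b with hc | hc | hc
    · rw [if_pos (by omega), if_pos (by omega)]
      exact h.adj_iterate (by omega)
    · rw [if_pos (by omega), if_neg (by omega), hc, show b + 1 - (b + 1) = 0 by omega]
      have := hup (b - 2)
      rw [show b - 2 + 2 = b by omega] at this
      rw [← this]
      exact hwb.symm
    · rw [if_neg (by omega), if_neg (by omega), show i + 1 - (b + 1) = i - (b + 1) + 1 by omega]
      exact h.adj_iterate (by omega)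
  · rw [if_pos (by omega), if_pos (by omega)]
    exact hva
  · rw [if_pos (by omega), if_neg (by omega), show b + 3 - 1 - (b + 1) = 1 by omega, ← hup 0]
    exact (h.adj_iterate (k := 1) (by omega)).symm

/-- The theta graph with path lengths `1`, `j` and `b - j + 1`, with branch vertices `v` and its
parent. -/
theorem not_sibling_chords (h : IsNormalForestOn H Finset.univ d par)
    (hH : IsRootedContractible H) {v w : V} {j b : ℕ} (hj : j % 2 = 0) (hb : b % 2 = 0)
    (hj4 : 4 ≤ j) (hjb : j + 4 ≤ b) (hbd : b ≤ d v) (hd : d v = d w) (hvw : v ≠ w)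
    (hpar : par v = par w) (hv1 : H.Adj v (par^[j] v)) (hv2 : H.Adj v (par^[j + 2] v))
    (hwb : H.Adj w (par^[b] w)) : False := by
  have hup : ∀ k, par^[k + 1] w = par^[k + 1] v := fun k => by
    rw [Function.iterate_succ_apply, ← hpar, ← Function.iterate_succ_apply]
  -- The path climbs from the parent of `v` and `w`, bypasses the `(j + 1)`-st ancestor through `v`,
  -- and returns from the `b`-th ancestor to `w`
  refine not_isRootedContractible_of_seq (n := b + 1) (s := j) (t := 0)
    ⟨by omega, by omega, by omega, by omega, by omega, by omega, by omega, by omega⟩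
    (fun m => if m < b then par^[if m = j then 0 else m + 1] v else w) ?_ ?_ ?_ ?_ hH
  · intro i k hik hk
    rw [if_pos (show i < b by omega)]
    by_cases hkb : k < b
    · rw [if_pos hkb]
      apply h.iterate_ne rfl <;> split_ifs <;> omega
    · rw [if_neg hkb]
      split_ifs with h1
      · exact hvw
      · exact h.iterate_ne (j := 0) hd (by omega) (by omega) (by omega)
  · intro i hi
    rw [if_pos (show i < b by omega)]
    by_cases hib : i + 1 < b
    · rw [if_pos hib]
      rcases lt_trichotomy i j with hc | hc | hc
      · by_cases hij : i + 1 = j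
        · rw [if_neg (by omega), if_pos hij, hij]
          exact hv1.symm
        · rw [if_neg (by omega), if_neg hij]
          exact h.adj_iterate (by omega)
      · rw [if_pos hc, if_neg (by omega), hc]
        exact hv2
      · rw [if_neg (by omega), if_neg (by omega)]
        exact h.adj_iterate (by omega)
    · rw [if_neg hib, if_neg (by omega), ← hup, show i + 1 = b by omega]
      exact hwb.symm
  · rw [if_pos (show 0 < b by omega), if_pos (show j < b by omega), if_neg (show 0 ≠ j by omega),
      if_pos rfl]
    exact (h.adj_iterate (k := 0) (by omega)).symm
  · rw [if_pos (show 0 < b by omega), if_neg (show ¬ b + 1 - 1 < b by omega),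
      if_neg (show 0 ≠ j by omega), ← hup]
    exact (h.adj_iterate (k := 0) (by omega)).symm

end IsNormalForestOn

/-! ### Three-colouring the edges that preserve the parity of the depth -/

/-- A set of at least three even numbers `≥ 2` whose members `≥ 4` differ by less than four. -/
theorem eq_triple_of_close {I : Finset ℕ} (heven : ∀ i ∈ I, i % 2 = 0) (hpos : ∀ i ∈ I, 2 ≤ i)
    (hclose : ∀ i ∈ I, ∀ k ∈ I, 4 ≤ i → k < i + 4) (hcard : 3 ≤ I.card) :
    ∃ j, 4 ≤ j ∧ j % 2 = 0 ∧ I = {2, j, j + 2} := by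
  have h1 : I.card - 1 ≤ (I.erase 2).card := Finset.pred_card_le_card_erase
  have hJ : (I.erase 2).Nonempty := Finset.card_pos.1 (by omega)
  have hJ4 : ∀ i ∈ I.erase 2, 4 ≤ i := fun i hi => by
    obtain ⟨h2, h3⟩ := Finset.mem_erase.1 hi
    have := heven i h3; have := hpos i h3
    omega
  obtain ⟨j, hj, hmin⟩ := Finset.exists_min_image _ id hJ
  have hjI := Finset.mem_of_mem_erase hj
  have hj4 := hJ4 j hj
  have hj2 := heven j hjI
  have hsub : I.erase 2 ⊆ {j, j + 2} := fun k hk => by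
    have hkI := Finset.mem_of_mem_erase hk
    have h2 : j ≤ k := hmin k hk
    have h3 := hclose j hjI k hkI hj4
    have h4 := heven k hkI
    rw [Finset.mem_insert, Finset.mem_singleton]
    omega
  have hc2 : ({j, j + 2} : Finset ℕ).card = 2 := Finset.card_pair (by omega)
  have h2I : 2 ∈ I := by
    by_contra h2
    rw [Finset.erase_eq_of_notMem h2] at hsub
    have := Finset.card_le_card hsub
    omega
  refine ⟨j, hj4, hj2, ?_⟩
  rw [← Finset.eq_of_subset_of_card_le hsub (by omega), Finset.insert_erase h2I]

open Classical in
/-- The `i` such that `v` is joined by an edge of `H` to its `i`-th ancestor, `i` is even, and this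
ancestor lies in `Q`. -/
noncomputable def evenChords {V : Type u} (H : SimpleGraph V) (d : V → ℕ) (par : V → V)
    (Q : Finset V) (v : V) : Finset ℕ :=
  (Finset.range (d v + 1)).filter fun i => i % 2 = 0 ∧ H.Adj v (par^[i] v) ∧ par^[i] v ∈ Q

theorem mem_evenChords {V : Type u} {H : SimpleGraph V} {d : V → ℕ} {par : V → V}
    {Q : Finset V} {v : V} {i : ℕ} :
    i ∈ evenChords H d par Q v ↔
    i ≤ d v ∧ i % 2 = 0 ∧ H.Adj v (par^[i] v) ∧ par^[i] v ∈ Q := by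
  simp [evenChords]

namespace IsNormalForestOn
variable {V : Type u} [Fintype V] {H : SimpleGraph V} {d : V → ℕ} {par : V → V}

theorem exists_mem_evenChords (h : IsNormalForestOn H Finset.univ d par) {Q : Finset V} {v x : V}
    (hx : x ∈ Q) (hvx : H.Adj v x) (hpar : d v % 2 = d x % 2) (hle : d x ≤ d v) :
    ∃ i ∈ evenChords H d par Q v, par^[i] v = x ∧ d x + i = d v := by
  have h1 := h.ancestor v (Finset.mem_univ _) x (Finset.mem_univ _) hvx hle
  refine ⟨d v - d x, mem_evenChords.2 ⟨by omega, by omega, ?_, ?_⟩, h1, by omega⟩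
  · rwa [h1]
  · rwa [h1]

theorem evenChords_eq_triple (h : IsNormalForestOn H Finset.univ d par)
    (hH : IsRootedContractible H) {Q : Finset V} {v : V} (hv : 3 ≤ (evenChords H d par Q v).card) :
    ∃ j, 4 ≤ j ∧ j % 2 = 0 ∧ evenChords H d par Q v = {2, j, j + 2} := by
  refine eq_triple_of_close (fun i hi => (mem_evenChords.1 hi).2.1) ?_ ?_ hv
  · intro i hi
    obtain ⟨-, h1, h2, -⟩ := mem_evenChords.1 hi
    rcases Nat.eq_zero_or_pos i with rfl | h3
    · exact absurd rfl h2.ne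
    · omega
  · intro i hi k hk hi4
    obtain ⟨-, h1, h2, -⟩ := mem_evenChords.1 hi
    obtain ⟨h3, h4, h5, -⟩ := mem_evenChords.1 hk
    by_contra hc
    exact h.not_two_long_chords hH h1 h4 hi4 (by omega) h3 h2 h5

/-- Two vertices with the same grandparent and three even chords each are siblings, and their chords go
to the same ancestors. -/
theorem evenChords_eq_of_grandparent_eq (h : IsNormalForestOn H Finset.univ d par)
    (hH : IsRootedContractible H) {Q : Finset V} {v w : V} {j k : ℕ} (hd : d v = d w)
    (hgrand : par^[2] v = par^[2] w) (hj4 : 4 ≤ j) (hj : j % 2 = 0) (hk4 : 4 ≤ k) (hk : k % 2 = 0)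
    (hv : evenChords H d par Q v = {2, j, j + 2}) (hw : evenChords H d par Q w = {2, k, k + 2}) :
    par v = par w ∧ j = k := by
  have hv1 := mem_evenChords.1 (show j ∈ evenChords H d par Q v by simp [hv])
  have hv2 := mem_evenChords.1 (show j + 2 ∈ evenChords H d par Q v by simp [hv])
  have hw1 := mem_evenChords.1 (show k ∈ evenChords H d par Q w by simp [hw])
  have hw2 := mem_evenChords.1 (show k + 2 ∈ evenChords H d par Q w by simp [hw])
  have hpar : par v = par w := by
    by_contra hne
    rcases le_total j k with hjk | hjk
    · exact h.not_cousin_chords hH hj hk hj4 hjk (by omega) hd hne hgrand hv1.2.2.1 hw1.2.2.1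
    · exact h.not_cousin_chords hH hk hj hk4 hjk (by omega) hd.symm (Ne.symm hne) hgrand.symm
        hw1.2.2.1 hv1.2.2.1
  refine ⟨hpar, ?_⟩
  by_contra hne
  have hvw : v ≠ w := by
    rintro rfl
    have h1 : j ∈ evenChords H d par Q v := by simp [hv]
    have h2 : k ∈ evenChords H d par Q v := by simp [hw]
    rw [hw] at h1
    rw [hv] at h2
    simp only [Finset.mem_insert, Finset.mem_singleton] at h1 h2
    omega
  rcases Nat.lt_or_gt_of_ne hne with hlt | hlt
  · exact h.not_sibling_chords hH hj (b := k + 2) (by omega) hj4 (by omega) (by omega) hd hvw hpar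
      hv1.2.2.1 hv2.2.2.1 hw2.2.2.1
  · exact h.not_sibling_chords hH hk (b := j + 2) (by omega) hk4 (by omega) (by omega) hd.symm
      hvw.symm hpar.symm hw1.2.2.1 hw2.2.2.1 hv2.2.2.1

/-- The edges that join vertices of the same depth parity form a 3-colourable graph. The proof removes
either a deepest vertex with at most two neighbours in this graph, or a vertex `g` together with all
its neighbours `W` among the deepest vertices. -/
theorem exists_three_coloring (h : IsNormalForestOn H Finset.univ d par)
    (hH : IsRootedContractible H) (Q : Finset V) : ∃ c : V → Fin 3,
      ∀ x ∈ Q, ∀ y ∈ Q, H.Adj x y → d x % 2 = d y % 2 → c x ≠ c y := by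
  classical
  induction Q using Finset.strongInduction with
  | H Q ih =>
  rcases Q.eq_empty_or_nonempty with rfl | hQ
  · exact ⟨fun _ => 0, by simp⟩
  obtain ⟨v, hv, hmax⟩ := Finset.exists_max_image Q d hQ
  by_cases hsmall : ∃ w ∈ Q, d w = d v ∧ (evenChords H d par Q w).card ≤ 2
  · obtain ⟨w, hw, hwv, hcard⟩ := hsmall
    obtain ⟨c, hc⟩ := ih (Q.erase w) (Finset.erase_ssubset hw)
    obtain ⟨κ, hκ⟩ : ∃ κ, κ ∉ (evenChords H d par Q w).image fun i => c (par^[i] w) := by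
      by_contra hcon
      push Not at hcon
      have h1 := Finset.card_le_card fun κ (_ : κ ∈ (Finset.univ : Finset (Fin 3))) => hcon κ
      have h2 := Finset.card_image_le (s := evenChords H d par Q w) (f := fun i => c (par^[i] w))
      simp only [Finset.card_univ, Fintype.card_fin] at h1
      omega
    have hnew : ∀ x ∈ Q, H.Adj w x → d w % 2 = d x % 2 → κ ≠ c x := by
      intro x hx hwx hp
      obtain ⟨i, hi, rfl, -⟩ := h.exists_mem_evenChords hx hwx hp (by rw [hwv]; exact hmax x hx)
      exact fun e => hκ (Finset.mem_image.2 ⟨i, hi, e.symm⟩)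
    refine ⟨Function.update c w κ, fun x hx y hy hxy hp => ?_⟩
    by_cases hxw : x = w
    · subst hxw
      rw [Function.update_self, Function.update_of_ne hxy.ne']
      exact hnew y hy hxy hp
    · rw [Function.update_of_ne hxw]
      by_cases hyw : y = w
      · subst hyw
        rw [Function.update_self]
        exact (hnew x hx hxy.symm hp.symm).symm
      · rw [Function.update_of_ne hyw]
        exact hc x (Finset.mem_erase.2 ⟨hxw, hx⟩) y (Finset.mem_erase.2 ⟨hyw, hy⟩) hxy hp
  · have hbig : ∀ w ∈ Q, d w = d v → 3 ≤ (evenChords H d par Q w).card := by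
      intro w hw hwv
      by_contra hlt
      exact hsmall ⟨w, hw, hwv, by omega⟩
    obtain ⟨j, hj4, hj, htv⟩ := h.evenChords_eq_triple hH (hbig v hv rfl)
    have hv2 := mem_evenChords.1 (show 2 ∈ evenChords H d par Q v by simp [htv])
    have hvj := mem_evenChords.1 (show j ∈ evenChords H d par Q v by simp [htv])
    have hvj2 := mem_evenChords.1 (show j + 2 ∈ evenChords H d par Q v by simp [htv])
    set g := par^[2] v with hg
    have hdg : d g + 2 = d v := h.depth_iterate hv2.1
    let W := Q.filter fun w => d w = d v ∧ par^[2] w = g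
    have hW : ∀ w, w ∈ W ↔ w ∈ Q ∧ d w = d v ∧ par^[2] w = g := fun w => Finset.mem_filter
    have hgW : g ∉ W := fun hgW => by
      have := ((hW g).1 hgW).2.1
      omega
    -- all members of `W` have the same neighbours of their own parity in `Q`
    have hWnbr : ∀ w ∈ W, ∀ x ∈ Q, H.Adj w x → d w % 2 = d x % 2 →
        x = g ∨ x = par^[j] v ∨ x = par^[j + 2] v := by
      intro w hw x hx hwx hp
      obtain ⟨hwQ, hwd, hwg⟩ := (hW w).1 hw
      obtain ⟨k, hk4, hk, htw⟩ := h.evenChords_eq_triple hH (hbig w hwQ hwd)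
      obtain ⟨hpar, rfl⟩ := h.evenChords_eq_of_grandparent_eq hH hwd.symm hwg.symm hj4 hj hk4 hk
        htv htw
      obtain ⟨i, hi, rfl, -⟩ := h.exists_mem_evenChords hx hwx hp (by rw [hwd]; exact hmax x hx)
      have hup : ∀ m, par^[m + 1] w = par^[m + 1] v := fun m => by
        rw [Function.iterate_succ_apply, ← hpar, ← Function.iterate_succ_apply]
      rw [htw] at hi
      simp only [Finset.mem_insert, Finset.mem_singleton] at hi
      rcases hi with rfl | rfl | rfl
      · exact Or.inl hwg
      · obtain ⟨m, rfl⟩ : ∃ m, i = m + 1 := ⟨i - 1, by omega⟩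
        exact Or.inr (Or.inl (hup m))
      · exact Or.inr (Or.inr (hup _))
    -- apart from `W`, the only such neighbour of `g` is its own grandparent
    have hgnbr : ∀ x ∈ Q, x ∉ W → H.Adj g x → d g % 2 = d x % 2 → x = par^[4] v := by
      intro x hx hxW hgx hp
      have hxv := hmax x hx
      rcases le_or_gt (d x) (d g) with hle | hlt
      · obtain ⟨i, hi, rfl, hid⟩ := h.exists_mem_evenChords hx hgx hp hle
        obtain ⟨h1, h2, h3, -⟩ := mem_evenChords.1 hi
        rw [hg, ← Function.iterate_add_apply] at h3 hid hgx ⊢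
        have hi0 : i ≠ 0 := by
          rintro rfl
          exact hgx.ne rfl
        have hi4 : ¬ 6 ≤ i + 2 := by
          intro h6
          by_cases hij : j = i + 2
          · exact h.not_crossing_chords hH (a := j + 2) (b := i + 2) (by omega) (by omega) (by omega)
              h6 (by omega) hvj2.1 (by omega) hvj2.2.2.1 h3
          · exact h.not_crossing_chords hH (a := j) (b := i + 2) (by omega) (by omega) (by omega)
              h6 hij hvj.1 (by omega) hvj.2.2.1 h3
        obtain rfl : i = 2 := by omega
        rfl
      · refine absurd ((hW x).2 ⟨hx, by omega, ?_⟩) hxW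
        have := h.ancestor x (Finset.mem_univ _) g (Finset.mem_univ _) hgx.symm (by omega)
        rwa [show d x - d g = 2 by omega] at this
    obtain ⟨c, hc⟩ := ih (Q.filter fun x => x ≠ g ∧ x ∉ W)
      (Finset.filter_ssubset.2 ⟨g, hv2.2.2.2, by simp⟩)
    -- `κ` is for `g` and `μ` for `W`; `κ` can be chosen so that it does not use up a third colour
    -- besides those of the two other neighbours of `W`
    obtain ⟨κ, μ, hκ, hμκ, hμ1, hμ2⟩ : ∃ κ μ : Fin 3, κ ≠ c (par^[4] v) ∧ μ ≠ κ ∧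
        μ ≠ c (par^[j] v) ∧ μ ≠ c (par^[j + 2] v) := by
      generalize c (par^[4] v) = a, c (par^[j] v) = b, c (par^[j + 2] v) = e
      revert a b e
      decide
    let c' : V → Fin 3 := fun x => if x = g then κ else if x ∈ W then μ else c x
    have hc'g : c' g = κ := if_pos rfl
    have hc'W : ∀ x ∈ W, c' x = μ := fun x hx => by
      have : x ≠ g := fun e => hgW (e ▸ hx)
      simp only [c', if_neg this, if_pos hx]
    have hc'o : ∀ x, x ≠ g → x ∉ W → c' x = c x := fun x h1 h2 => by
      simp only [c', if_neg h1, if_neg h2]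
    have hanc : ∀ i, 3 ≤ i → i ≤ d v → c' (par^[i] v) = c (par^[i] v) := by
      intro i hi3 hid
      have h1 := h.depth_iterate hid
      refine hc'o _ (fun e => ?_) (fun e => ?_)
      · rw [e] at h1; omega
      · have := ((hW _).1 e).2.1; omega
    have hWok : ∀ w ∈ W, ∀ x ∈ Q, H.Adj w x → d w % 2 = d x % 2 → c' w ≠ c' x := by
      intro w hw x hx hwx hp
      rw [hc'W w hw]
      rcases hWnbr w hw x hx hwx hp with rfl | rfl | rfl
      · rwa [hc'g]
      · rwa [hanc j (by omega) hvj.1]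
      · rwa [hanc (j + 2) (by omega) hvj2.1]
    have hgok : ∀ x ∈ Q, H.Adj g x → d g % 2 = d x % 2 → c' g ≠ c' x := by
      intro x hx hgx hp
      by_cases hxW : x ∈ W
      · exact (hWok x hxW g hv2.2.2.2 hgx.symm hp.symm).symm
      · have hx4 := hgnbr x hx hxW hgx hp
        rw [hc'g, hc'o x hgx.ne' hxW, hx4]
        exact hκ
    refine ⟨c', fun x hx y hy hxy hp => ?_⟩
    by_cases hxW : x ∈ W
    · exact hWok x hxW y hy hxy hp
    by_cases hyW : y ∈ W
    · exact (hWok y hyW x hx hxy.symm hp.symm).symm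
    by_cases hxg : x = g
    · rw [hxg] at hxy hp ⊢
      exact hgok y hy hxy hp
    by_cases hyg : y = g
    · rw [hyg] at hxy hp ⊢
      exact (hgok x hx hxy.symm hp.symm).symm
    rw [hc'o x hxg hxW, hc'o y hyg hyW]
    exact hc x (Finset.mem_filter.2 ⟨hx, hxg, hxW⟩) y (Finset.mem_filter.2 ⟨hy, hyg, hyW⟩) hxy hp

end IsNormalForestOn

/-- The parity of the depth and a 3-colouring of the edges that preserve it give six colours. -/
theorem IsRootedContractible.colorable_six {V : Type u} [Finite V] {H : SimpleGraph V}
    (hH : IsRootedContractible H) : H.Colorable 6 := by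
  have := Fintype.ofFinite V
  obtain ⟨d, par, hF, -⟩ := IsNormalForestOn.exists_of_priority H Finset.univ fun _ => 0
  obtain ⟨c, hc⟩ := hF.exists_three_coloring hH Finset.univ
  let C : H.Coloring (Fin 2 × Fin 3) := Coloring.mk
    (fun v => (⟨d v % 2, Nat.mod_lt _ two_pos⟩, c v)) fun {x y} hxy e => by
      rw [Prod.mk.injEq, Fin.mk.injEq] at e
      exact hc x (Finset.mem_univ _) y (Finset.mem_univ _) hxy e.1 e.2
  simpa using C.colorable

theorem mainTheorem1 {V : Type u} [Finite V] (H : SimpleGraph V) :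
    (IsRootedContractible H → H.Colorable 6) ∧
      (7 ≤ H.chromaticNumber → ¬ IsRootedContractible H) := by
  refine ⟨fun hH => hH.colorable_six, fun h7 hH => ?_⟩
  have h6 : H.chromaticNumber ≤ 6 := hH.colorable_six.chromaticNumber_le
  exact absurd (h7.trans h6) (by decide)
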